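/- For integers $k_1\ge 2$ and $k_2,\dots,k_r\ge 1$, define the multiple zeta values and the multiple $T$-values by the convergent series $$\zeta(k_1,\dots,k_r)=\sum_{n_1>\cdots>n_r>0}\frac{1}{n_1^{k_1}\cdots n_r^{k_r}},\qquad T(k_1,\dots,k_r)=\sum_{\substack{n_1>\cdots>n_r>0\\ n_j\equiv r+1-j\ (\mathrm{mod}\ 2)}}\frac{2^r}{n_1^{k_1}\cdots n_r^{k_r}}.$$ Let $q\ge 1$ and $p,m\ge 2$ be integers. Then $$\sum_{\substack{i+j=m-1\\ i,j\ge 0}}\binom{p+i-1}{i}\binom{q+j-1}{j}\zeta(p+i,q+j)-(-1)^q\sum_{\substack{i+j=p-1\\ i,j\ge 0}}\binom{m+i-1}{i}\binom{q+j-1}{j}\zeta(m+i,q+j)=\sum_{\substack{i+j=q-1\\ i,j\ge 0}}(-1)^j\binom{m+i-1}{i}\binom{p+j-1}{j}\zeta(m+i)\zeta(p+j)$$ and $$\sum_{\substack{i+j=m-1\\ i,j\ge 0}}\binom{p+i-1}{i}\binom{q+j-1}{j}T(p+i,q+j)-(-1)^q\sum_{\substack{i+j=p-1\\ i,j\ge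 0}}\binom{m+i-1}{i}\binom{q+j-1}{j}T(m+i,q+j)=\sum_{\substack{i+j=q-1\\ i,j\ge 0}}(-1)^j\binom{m+i-1}{i}\binom{p+j-1}{j}T(m+i)T(p+j).$$ -/

import Mathlib

/-- The index set `n₁ > n₂ > ⋯ > n_r > 0` of the series for multiple zeta values of depth `r`
(`n_j` is `n (j - 1)` here, since `Fin r` counts from `0`). -/
def zetaIndex (r : ℕ) : Set (Fin r → ℕ) :=
  {n | StrictAnti n ∧ ∀ j, 0 < n j}

/-- The index set `n₁ > n₂ > ⋯ > n_r > 0`, `n_j ≡ r + 1 - j (mod 2)`, of the series for multiple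
`T`-values of depth `r`; since `Fin r` counts from `0`, the parity condition reads
`n j ≡ r - j (mod 2)`. -/
def tIndex (r : ℕ) : Set (Fin r → ℕ) :=
  {n | StrictAnti n ∧ (∀ j, 0 < n j) ∧ ∀ j, n j ≡ r - (j : ℕ) [MOD 2]}

/-- The multiple zeta value
`ζ(k₁, …, k_r) = ∑_{n₁ > ⋯ > n_r > 0} 1 / (n₁ ^ k₁ ⋯ n_r ^ k_r)`. -/
noncomputable def multipleZeta {r : ℕ} (k : Fin r → ℕ) : ℝ :=
  ∑' n : zetaIndex r, 1 / ∏ j, ((n : Fin r → ℕ) j : ℝ) ^ k j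

/-- The multiple `T`-value
`T(k₁, …, k_r) = ∑_{n₁ > ⋯ > n_r > 0, n_j ≡ r + 1 - j (mod 2)} 2 ^ r / (n₁ ^ k₁ ⋯ n_r ^ k_r)`. -/
noncomputable def multipleT {r : ℕ} (k : Fin r → ℕ) : ℝ :=
  ∑' n : tIndex r, 2 ^ r / ∏ j, ((n : Fin r → ℕ) j : ℝ) ^ k j

theorem summable_prod_fin (f : ℕ → ℝ) (hf : Summable f) (h0 : ∀ n, 0 ≤ f n) (r : ℕ) :
    Summable fun n : Fin r → ℕ => ∏ j, f (n j) := by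
  induction r with
  | zero => exact Summable.of_finite
  | succ r ih =>
    rw [← (Fin.consEquiv fun _ : Fin (r + 1) => ℕ).summable_iff]
    have h := hf.mul_of_nonneg ih h0 (fun n => Finset.prod_nonneg fun j _ => h0 _)
    refine h.congr fun x => ?_
    simp [Fin.prod_univ_succ, Fin.consEquiv]

/-- The series defining `ζ(k)` converges for every admissible `k`, so that `multipleZeta k`
is its sum. -/
theorem summable_multipleZeta {r : ℕ} (k : Fin (r + 1) → ℕ) (hk : ∀ j, 1 ≤ k j)
    (hk0 : 2 ≤ k 0) :
    Summable fun n : zetaIndex (r + 1) => 1 / ∏ j, ((n : Fin (r + 1) → ℕ) j : ℝ) ^ k j := by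
  set c : ℝ := 1 / ((r : ℝ) + 1) with hc
  have hr : (0 : ℝ) < (r : ℝ) + 1 := by positivity
  have hc0 : 0 < c := by positivity
  have hs : Summable fun n : ℕ => 1 / (n : ℝ) ^ (1 + c) :=
    Real.summable_one_div_nat_rpow.2 (by linarith)
  have hp := (summable_prod_fin _ hs (fun n => by positivity) (r + 1)).subtype
    (zetaIndex (r + 1))
  refine Summable.of_nonneg_of_le (fun n => by positivity) ?_ hp
  rintro ⟨n, hn, hpos⟩
  simp only [Function.comp_apply, Finset.prod_div_distrib, Finset.prod_const_one]
  have h1 : ∀ j, (1 : ℝ) ≤ n j := fun j => by exact_mod_cast hpos j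
  have hP : (0 : ℝ) < ∏ j, (n j : ℝ) ^ (1 + c) :=
    Finset.prod_pos fun j _ => Real.rpow_pos_of_pos (by linarith [h1 j]) _
  refine one_div_le_one_div_of_le hP ?_
  calc ∏ j, (n j : ℝ) ^ (1 + c) = (∏ j, (n j : ℝ)) * ∏ j, (n j : ℝ) ^ c := by
        rw [← Finset.prod_mul_distrib]
        refine Finset.prod_congr rfl fun j _ => ?_
        rw [Real.rpow_add (by linarith [h1 j]), Real.rpow_one]
    _ ≤ (∏ j, (n j : ℝ)) * ∏ _j : Fin (r + 1), (n 0 : ℝ) ^ c := by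
        refine mul_le_mul_of_nonneg_left ?_ (by positivity)
        refine Finset.prod_le_prod (fun j _ => by positivity) fun j _ => ?_
        exact Real.rpow_le_rpow (by positivity)
          (by exact_mod_cast hn.antitone (Fin.zero_le j)) hc0.le
    _ = (∏ j, (n j : ℝ)) * n 0 := by
        rw [Finset.prod_const, Finset.card_univ, Fintype.card_fin, ← Real.rpow_mul_natCast
          (by positivity)]
        have : c * ((r + 1 : ℕ) : ℝ) = 1 := by rw [hc]; push_cast; field_simp
        rw [this, Real.rpow_one]
    _ = (n 0 : ℝ) ^ 2 * ∏ j : Fin r, (n j.succ : ℝ) := by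
        rw [Fin.prod_univ_succ]; ring
    _ ≤ (n 0 : ℝ) ^ k 0 * ∏ j : Fin r, (n j.succ : ℝ) ^ k j.succ := by
        refine mul_le_mul (pow_le_pow_right₀ (h1 0) hk0) ?_ (by positivity) (by positivity)
        refine Finset.prod_le_prod (fun j _ => by positivity) fun j _ => ?_
        exact le_self_pow₀ (h1 _) (by have := hk j.succ; omega)
    _ = ∏ j, (n j : ℝ) ^ k j := by rw [Fin.prod_univ_succ]

/-- The series defining `T(k)` converges for every admissible `k`, so that `multipleT k`
is its sum. -/
theorem summable_multipleT {r : ℕ} (k : Fin (r + 1) → ℕ) (hk : ∀ j, 1 ≤ k j)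
    (hk0 : 2 ≤ k 0) :
    Summable fun n : tIndex (r + 1) =>
      2 ^ (r + 1) / ∏ j, ((n : Fin (r + 1) → ℕ) j : ℝ) ^ k j := by
  have h := (summable_multipleZeta k hk hk0).mul_left ((2 : ℝ) ^ (r + 1))
  have hsub : tIndex (r + 1) ⊆ zetaIndex (r + 1) := fun n hn => ⟨hn.1, hn.2.1⟩
  have h2 := h.comp_injective (Set.inclusion_injective hsub)
  refine h2.congr fun n => ?_
  simp [div_eq_mul_inv]

/-! Both relations come from one partial fraction identity for `1 / (x ^ m * y ^ p)` and its
derivatives, with `z = x + y`, summed over all pairs `x, y ∈ S`. For `S` the positive integers, `n₁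
= x + y`, `n₂ = x` turns the terms `1 / (z ^ a * x ^ b)` into `ζ(a, b)`; for `S` the odd numbers it
gives `T(a, b) / 4`. The terms in `x` and `y` alone factor into products of single sums. The
binomial sums are Cauchy products of coefficients of powers of `1 / (a - t)`, so the identity
concerns three coefficients (`coeff_partial_fractions`). Both sides obey the same recursion in `p`
and `m`. -/

/-! ### Partial fractions via power series. -/

/-- The expansion of `1 / (a - t)` as a power series in `t`. -/
noncomputable def invSubSeries (a : ℝ) : PowerSeries ℝ :=
  PowerSeries.mk fun n => (a ^ (n + 1))⁻¹

theorem C_sub_X_mul_invSubSeries {a : ℝ} (ha : a ≠ 0) :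
    (PowerSeries.C a - PowerSeries.X) * invSubSeries a = 1 := by
  ext n
  cases n with
  | zero => simp [sub_mul, invSubSeries, ha]
  | succ n =>
    rw [sub_mul, map_sub, PowerSeries.coeff_C_mul, PowerSeries.coeff_succ_X_mul]
    simp only [invSubSeries, PowerSeries.coeff_mk, PowerSeries.coeff_one]
    rw [pow_succ a (n + 1)]
    field_simp
    simp

theorem coeff_invSubSeries_pow (a : ℝ) (k n : ℕ) :
    PowerSeries.coeff n (invSubSeries a ^ (k + 1)) =
      ((k + n).choose n : ℝ) * (a ^ (k + 1 + n))⁻¹ := by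
  have h : invSubSeries a = PowerSeries.C a⁻¹ * PowerSeries.rescale a⁻¹ (PowerSeries.mk 1) := by
    ext n
    simp [invSubSeries, PowerSeries.coeff_rescale, pow_succ, mul_comm]
  rw [h, mul_pow, ← map_pow, ← map_pow, PowerSeries.mk_one_pow_eq_mk_choose_add,
    PowerSeries.coeff_C_mul, PowerSeries.coeff_rescale, PowerSeries.coeff_mk,
    Nat.choose_symm_add, pow_add a (k + 1) n, mul_inv, inv_pow, inv_pow]
  ring

/-- The coefficients of the powers of `1 / (y + t)`. -/
theorem coeff_neg_invSubSeries_neg_pow (y : ℝ) (p j : ℕ) :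
    PowerSeries.coeff j ((-invSubSeries (-y)) ^ (p + 1)) =
      (-1) ^ j * ((p + j).choose j : ℝ) * (y ^ (p + 1 + j))⁻¹ := by
  have h1 : (-invSubSeries (-y)) ^ (p + 1) =
      PowerSeries.C ((-1) ^ (p + 1)) * invSubSeries (-y) ^ (p + 1) := by
    rw [neg_pow]; simp
  have h2 : ((-y) ^ (p + 1 + j))⁻¹ = (-1) ^ (p + 1) * (-1) ^ j * (y ^ (p + 1 + j))⁻¹ := by
    rw [neg_pow, mul_inv, ← pow_add, ← inv_pow]; norm_num
  have h3 : ((-1 : ℝ) ^ (p + 1)) * (-1) ^ (p + 1) = 1 := by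
    rw [← mul_pow]; norm_num
  rw [h1, PowerSeries.coeff_C_mul, coeff_invSubSeries_pow, h2]
  linear_combination ((-1) ^ j * ((p + j).choose j : ℝ) * (y ^ (p + 1 + j))⁻¹) * h3

/-- Partial fractions for `1 / (x ^ m * y ^ p)` in the form of an identity between coefficients
of power series. -/
theorem coeff_partial_fractions {x y z : ℝ} (hx : x ≠ 0) (hy : y ≠ 0) (hz : z ≠ 0)
    (hxyz : x + y = z) (q p m : ℕ) :
    PowerSeries.coeff m (invSubSeries z ^ (p + 1) * invSubSeries x ^ (q + 1)) +
      (-1) ^ q * PowerSeries.coeff p (invSubSeries z ^ (m + 1) * invSubSeries y ^ (q + 1)) =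
    PowerSeries.coeff q (invSubSeries x ^ (m + 1) * (-invSubSeries (-y)) ^ (p + 1)) := by
  have hX := C_sub_X_mul_invSubSeries hx
  have hY := C_sub_X_mul_invSubSeries (neg_ne_zero.2 hy)
  have hZ := C_sub_X_mul_invSubSeries hz
  set u := invSubSeries x
  set v := invSubSeries (-y)
  set w := invSubSeries z
  set s := invSubSeries y
  -- Recursion of the right side, from `z = (x - t) + (y + t)`: each summand cancels one factor.
  have hR : ∀ p m : ℕ, z * PowerSeries.coeff q (u ^ (m + 1) * (-v) ^ (p + 1)) =
      PowerSeries.coeff q (u ^ m * (-v) ^ (p + 1)) +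
        PowerSeries.coeff q (u ^ (m + 1) * (-v) ^ p) := by
    intro p m
    rw [← PowerSeries.coeff_C_mul, ← map_add]
    congr 1
    have hC : PowerSeries.C z = (PowerSeries.C x - PowerSeries.X) -
        (PowerSeries.C (-y) - PowerSeries.X) := by
      rw [← hxyz]; simp
    rw [hC]
    linear_combination (u ^ m * (-v) ^ (p + 1)) * hX + (u ^ (m + 1) * (-v) ^ p) * hY
  -- The same recursion for both terms on the left, from `z = t + (z - t)`.
  have hw : ∀ (f : PowerSeries ℝ) (k n : ℕ),
      z * PowerSeries.coeff (n + 1) (w ^ (k + 1) * f) =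
        PowerSeries.coeff n (w ^ (k + 1) * f) + PowerSeries.coeff (n + 1) (w ^ k * f) := by
    intro f k n
    rw [← PowerSeries.coeff_C_mul, ← PowerSeries.coeff_succ_X_mul n, ← map_add]
    congr 1
    linear_combination (w ^ k * f) * hZ
  have hw0 : ∀ (f : PowerSeries ℝ) (k : ℕ),
      z * PowerSeries.coeff 0 (w ^ (k + 1) * f) = PowerSeries.coeff 0 (w ^ k * f) := by
    intro f k
    have h : PowerSeries.C z * (w ^ (k + 1) * f) =
        PowerSeries.X * (w ^ (k + 1) * f) + w ^ k * f := by
      linear_combination (w ^ k * f) * hZ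
    rw [← PowerSeries.coeff_C_mul, h, map_add, PowerSeries.coeff_zero_X_mul, zero_add]
  -- Boundary values, where the power of `1 / (z - t)` has dropped to `0`; they match by symmetry of
  -- the binomial coefficient.
  have hu : ∀ m, PowerSeries.coeff m (u ^ (q + 1)) = PowerSeries.coeff q (u ^ (m + 1)) := by
    intro m
    rw [coeff_invSubSeries_pow, coeff_invSubSeries_pow, add_comm q m, Nat.choose_symm_add,
      add_right_comm q 1 m, add_right_comm m 1 q, add_comm q m]
  have hv : ∀ p, (-1) ^ q * PowerSeries.coeff p (s ^ (q + 1)) =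
      PowerSeries.coeff q ((-v) ^ (p + 1)) := by
    intro p
    rw [coeff_neg_invSubSeries_neg_pow, coeff_invSubSeries_pow, add_comm q p,
      Nat.choose_symm_add, add_right_comm q 1 p, add_right_comm p 1 q, add_comm q p, mul_assoc]
  induction p generalizing m with
  | zero =>
    induction m with
    | zero =>
      apply mul_left_cancel₀ hz
      rw [hR, mul_add, mul_left_comm, hw0, hw0]
      simp only [pow_zero, one_mul, mul_one, hu, hv]
      ring
    | succ m ih =>
      apply mul_left_cancel₀ hz
      rw [hR, mul_add, mul_left_comm, hw, hw0, ← ih]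
      simp only [pow_zero, one_mul, mul_one, hu]
      ring
  | succ p ihp =>
    induction m with
    | zero =>
      apply mul_left_cancel₀ hz
      rw [hR, mul_add, mul_left_comm, hw, hw0, ← ihp]
      simp only [pow_zero, one_mul, ← hv]
      ring
    | succ m ih =>
      apply mul_left_cancel₀ hz
      rw [hR, mul_add, mul_left_comm, hw, hw, ← ihp, ← ih]
      ring

theorem partial_fractions {x y z : ℝ} (hx : x ≠ 0) (hy : y ≠ 0) (hz : z ≠ 0)
    (hxyz : x + y = z) (q p m : ℕ) :
    ∑ ij ∈ Finset.HasAntidiagonal.antidiagonal m,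
        ((p + ij.1).choose ij.1 : ℝ) * ((q + ij.2).choose ij.2 : ℝ) *
          (1 / (z ^ (p + 1 + ij.1) * x ^ (q + 1 + ij.2)))
      - (-1) ^ (q + 1) * ∑ ij ∈ Finset.HasAntidiagonal.antidiagonal p,
        ((m + ij.1).choose ij.1 : ℝ) * ((q + ij.2).choose ij.2 : ℝ) *
          (1 / (z ^ (m + 1 + ij.1) * y ^ (q + 1 + ij.2)))
      = ∑ ij ∈ Finset.HasAntidiagonal.antidiagonal q,
        (-1) ^ ij.2 * ((m + ij.1).choose ij.1 : ℝ) * ((p + ij.2).choose ij.2 : ℝ) *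
          (1 / x ^ (m + 1 + ij.1) * (1 / y ^ (p + 1 + ij.2))) := by
  have h := coeff_partial_fractions hx hy hz hxyz q p m
  rw [PowerSeries.coeff_mul, PowerSeries.coeff_mul, PowerSeries.coeff_mul] at h
  simp only [coeff_neg_invSubSeries_neg_pow] at h
  simp only [coeff_invSubSeries_pow] at h
  rw [pow_succ, mul_neg_one, neg_mul, sub_neg_eq_add]
  convert h using 2
  · exact Finset.sum_congr rfl fun _ _ => by rw [one_div, mul_inv]; ring
  · congr 1
    exact Finset.sum_congr rfl fun _ _ => by rw [one_div, mul_inv]; ring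
  · rw [one_div, one_div]; ring

/-! ### Summation over pairs. -/

/-- `∑ 1 / x ^ a` over `x ∈ S`. -/
noncomputable def singleSum (S : Set ℕ) (a : ℕ) : ℝ :=
  ∑' x : S, 1 / ((x : ℕ) : ℝ) ^ a

/-- `∑ 1 / ((x + y) ^ a * x ^ b)` over `x, y ∈ S`. -/
noncomputable def doubleSum (S : Set ℕ) (a b : ℕ) : ℝ :=
  ∑' xy : S × S, 1 / ((((xy.1 : ℕ) : ℝ) + ((xy.2 : ℕ) : ℝ)) ^ a * ((xy.1 : ℕ) : ℝ) ^ b)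

theorem summable_singleSum (S : Set ℕ) {a : ℕ} (ha : 2 ≤ a) :
    Summable fun x : S => 1 / ((x : ℕ) : ℝ) ^ a :=
  (Real.summable_one_div_nat_pow.2 ha).subtype S

theorem summable_doubleSum {S : Set ℕ} (hS : ∀ x ∈ S, 0 < x) {a b : ℕ} (ha : 2 ≤ a)
    (hb : 1 ≤ b) :
    Summable fun xy : S × S =>
      1 / ((((xy.1 : ℕ) : ℝ) + ((xy.2 : ℕ) : ℝ)) ^ a * ((xy.1 : ℕ) : ℝ) ^ b) := by
  have h := summable_multipleZeta ![a, b] (by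
    intro j; fin_cases j
    · exact le_trans one_le_two ha
    · exact hb) ha
  let e : S × S → zetaIndex 2 := fun xy => ⟨![xy.1 + xy.2, xy.1], by
    have h1 := hS _ xy.1.2
    have h2 := hS _ xy.2.2
    refine ⟨?_, fun j => ?_⟩
    · rw [Fin.strictAnti_iff_succ_lt]
      intro i; fin_cases i; simpa using h2
    · fin_cases j <;> simp <;> omega⟩
  have he : Function.Injective e := by
    rintro ⟨x, y⟩ ⟨x', y'⟩ hxy
    have h0 := congrFun (congrArg Subtype.val hxy) 0
    have h1 := congrFun (congrArg Subtype.val hxy) 1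
    simp only [e, Matrix.cons_val_zero, Matrix.cons_val_one] at h0 h1
    ext
    · exact h1
    · simp only; omega
  refine (h.comp_injective he).congr fun xy => ?_
  simp [e, Fin.prod_univ_two]

theorem doubleSum_relation {S : Set ℕ} (hS : ∀ x ∈ S, 0 < x) {q p m : ℕ} (hq : 1 ≤ q)
    (hp : 2 ≤ p) (hm : 2 ≤ m) :
    ∑ ij ∈ Finset.HasAntidiagonal.antidiagonal (m - 1),
        ((p + ij.1 - 1).choose ij.1 : ℝ) * ((q + ij.2 - 1).choose ij.2 : ℝ) *
          doubleSum S (p + ij.1) (q + ij.2)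
      - (-1 : ℝ) ^ q * ∑ ij ∈ Finset.HasAntidiagonal.antidiagonal (p - 1),
        ((m + ij.1 - 1).choose ij.1 : ℝ) * ((q + ij.2 - 1).choose ij.2 : ℝ) *
          doubleSum S (m + ij.1) (q + ij.2)
      = ∑ ij ∈ Finset.HasAntidiagonal.antidiagonal (q - 1),
        (-1 : ℝ) ^ ij.2 * ((m + ij.1 - 1).choose ij.1 : ℝ) * ((p + ij.2 - 1).choose ij.2 : ℝ) *
          (singleSum S (m + ij.1) * singleSum S (p + ij.2)) := by
  have h2 : ∀ {a b : ℕ}, 2 ≤ a → 1 ≤ b → HasSum (fun xy : S × S =>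
      1 / ((((xy.1 : ℕ) : ℝ) + ((xy.2 : ℕ) : ℝ)) ^ a * ((xy.1 : ℕ) : ℝ) ^ b))
      (doubleSum S a b) := fun ha hb => (summable_doubleSum hS ha hb).hasSum
  -- The second sum of the identity carries powers of `y`; swapping `x` and `y` leaves the double
  -- sum unchanged.
  have h2' : ∀ {a b : ℕ}, 2 ≤ a → 1 ≤ b → HasSum (fun xy : S × S =>
      1 / ((((xy.1 : ℕ) : ℝ) + ((xy.2 : ℕ) : ℝ)) ^ a * ((xy.2 : ℕ) : ℝ) ^ b))
      (doubleSum S a b) := fun ha hb => by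
    rw [← (Equiv.prodComm S S).hasSum_iff]
    convert h2 ha hb using 2 with xy
    simp [add_comm]
  have h1 : ∀ {a b : ℕ}, 2 ≤ a → 2 ≤ b → HasSum (fun xy : S × S =>
      1 / ((xy.1 : ℕ) : ℝ) ^ a * (1 / ((xy.2 : ℕ) : ℝ) ^ b))
      (singleSum S a * singleSum S b) := fun ha hb =>
    (summable_singleSum S ha).hasSum.mul (summable_singleSum S hb).hasSum
      ((summable_singleSum S ha).mul_of_nonneg (summable_singleSum S hb)
        (fun _ => by positivity) (fun _ => by positivity))
  have hL := (hasSum_sum (s := Finset.HasAntidiagonal.antidiagonal (m - 1)) fun ij _ =>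
    (h2 (a := p + ij.1) (b := q + ij.2) (by omega) (by omega)).mul_left
      (((p + ij.1 - 1).choose ij.1 : ℝ) * ((q + ij.2 - 1).choose ij.2 : ℝ))).sub
    ((hasSum_sum (s := Finset.HasAntidiagonal.antidiagonal (p - 1)) fun ij _ =>
      (h2' (a := m + ij.1) (b := q + ij.2) (by omega) (by omega)).mul_left
      (((m + ij.1 - 1).choose ij.1 : ℝ) * ((q + ij.2 - 1).choose ij.2 : ℝ))).mul_left
        ((-1 : ℝ) ^ q))
  have hR := hasSum_sum (s := Finset.HasAntidiagonal.antidiagonal (q - 1)) fun ij _ =>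
    (h1 (a := m + ij.1) (b := p + ij.2) (by omega) (by omega)).mul_left
      ((-1 : ℝ) ^ ij.2 * ((m + ij.1 - 1).choose ij.1 : ℝ) * ((p + ij.2 - 1).choose ij.2 : ℝ))
  -- The two families agree termwise, so their sums do. The identity is applied with `q, p, m` each
  -- lowered by one.
  refine (congrArg (HasSum · _) (funext fun xy => ?_)).mpr hR |> hL.unique
  obtain ⟨q, rfl⟩ := Nat.exists_eq_add_of_le' hq
  obtain ⟨p, rfl⟩ := Nat.exists_eq_add_of_le' (one_le_two.trans hp)
  obtain ⟨m, rfl⟩ := Nat.exists_eq_add_of_le' (one_le_two.trans hm)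
  have hx : (0 : ℝ) < ((xy.1 : ℕ) : ℝ) := by exact_mod_cast hS _ xy.1.2
  have hy : (0 : ℝ) < ((xy.2 : ℕ) : ℝ) := by exact_mod_cast hS _ xy.2.2
  have := partial_fractions hx.ne' hy.ne' (add_pos hx hy).ne' rfl q p m
  have hs : ∀ a b : ℕ, a + 1 + b - 1 = a + b := fun a b => by omega
  simpa only [hs, Nat.add_sub_cancel] using this

/-! ### Zeta and `T`-values as sums over `S`. -/

theorem multipleZeta_one (a : ℕ) : multipleZeta ![a] = singleSum {x | 0 < x} a := by
  let e : {x : ℕ | 0 < x} ≃ zetaIndex 1 :=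
    { toFun := fun x => ⟨![x], Subsingleton.strictAnti _, fun j => by
        fin_cases j; exact x.2⟩
      invFun := fun n => ⟨n.1 0, n.2.2 0⟩
      left_inv := fun x => rfl
      right_inv := fun n => by ext j; fin_cases j; rfl }
  rw [multipleZeta, singleSum, ← e.tsum_eq]
  exact tsum_congr fun x => by rw [Fin.prod_univ_one]; rfl

theorem multipleZeta_two (a b : ℕ) : multipleZeta ![a, b] = doubleSum {x | 0 < x} a b := by
  let e : {x : ℕ | 0 < x} × {x : ℕ | 0 < x} ≃ zetaIndex 2 :=
    { toFun := fun xy => ⟨![xy.1 + xy.2, xy.1], by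
        have h1 : 0 < xy.1.1 := xy.1.2
        have h2 : 0 < xy.2.1 := xy.2.2
        refine ⟨?_, fun j => ?_⟩
        · rw [Fin.strictAnti_iff_succ_lt]
          intro i; fin_cases i; simpa using h2
        · fin_cases j <;> simp <;> omega⟩
      invFun := fun n => (⟨n.1 1, n.2.2 1⟩, ⟨n.1 0 - n.1 1, Nat.sub_pos_of_lt (n.2.1 (by simp))⟩)
      left_inv := fun xy => by ext <;> simp
      right_inv := fun n => by
        have : n.1 1 < n.1 0 := n.2.1 (by simp)
        ext j; fin_cases j
        · simp only [Fin.zero_eta, Matrix.cons_val_zero]; omega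
        · rfl }
  rw [multipleZeta, doubleSum, ← e.tsum_eq]
  simp [e, Fin.prod_univ_two]

theorem multipleT_one (a : ℕ) : multipleT ![a] = 2 * singleSum {x | x % 2 = 1} a := by
  let e : {x : ℕ | x % 2 = 1} ≃ tIndex 1 :=
    { toFun := fun x => ⟨![x], Subsingleton.strictAnti _, fun j => by
        have h : x.1 % 2 = 1 := x.2
        fin_cases j; simp; omega, fun j => by fin_cases j; exact x.2⟩
      invFun := fun n => ⟨n.1 0, n.2.2.2 0⟩
      left_inv := fun x => rfl
      right_inv := fun n => by ext j; fin_cases j; rfl }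
  rw [multipleT, singleSum, ← e.tsum_eq, ← tsum_mul_left]
  exact tsum_congr fun x => by rw [Fin.prod_univ_one, pow_one, mul_one_div]; rfl

/-- The parity condition makes `n₁` even and `n₂` odd, so `n₁ - n₂` is again odd. -/
theorem multipleT_two (a b : ℕ) :
    multipleT ![a, b] = 2 ^ 2 * doubleSum {x | x % 2 = 1} a b := by
  let e : {x : ℕ | x % 2 = 1} × {x : ℕ | x % 2 = 1} ≃ tIndex 2 :=
    { toFun := fun xy => ⟨![xy.1 + xy.2, xy.1], by
        have h1 : xy.1.1 % 2 = 1 := xy.1.2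
        have h2 : xy.2.1 % 2 = 1 := xy.2.2
        refine ⟨?_, fun j => ?_, fun j => ?_⟩
        · rw [Fin.strictAnti_iff_succ_lt]
          intro i; fin_cases i; simp; omega
        · fin_cases j <;> simp <;> omega
        · fin_cases j <;> simp [Nat.ModEq] <;> omega⟩
      invFun := fun n => (⟨n.1 1, n.2.2.2 1⟩, ⟨n.1 0 - n.1 1, by
        have h : n.1 1 < n.1 0 := n.2.1 (by simp)
        have h0 : n.1 0 % 2 = 0 := n.2.2.2 0
        have h1 : n.1 1 % 2 = 1 := n.2.2.2 1
        simp only [Set.mem_ofPred_eq]; omega⟩)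
      left_inv := fun xy => by ext <;> simp
      right_inv := fun n => by
        have : n.1 1 < n.1 0 := n.2.1 (by simp)
        ext j; fin_cases j
        · simp only [Fin.zero_eta, Matrix.cons_val_zero]; omega
        · rfl }
  rw [multipleT, doubleSum, ← e.tsum_eq, ← tsum_mul_left]
  simp [e, Fin.prod_univ_two, div_eq_mul_inv]

theorem mainTheorem5 (q p m : ℕ) (hq : 1 ≤ q) (hp : 2 ≤ p) (hm : 2 ≤ m) :
    (∑ ij ∈ Finset.HasAntidiagonal.antidiagonal (m - 1),
        ((p + ij.1 - 1).choose ij.1 : ℝ) * ((q + ij.2 - 1).choose ij.2 : ℝ) *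
          multipleZeta ![p + ij.1, q + ij.2]
      - (-1 : ℝ) ^ q * ∑ ij ∈ Finset.HasAntidiagonal.antidiagonal (p - 1),
        ((m + ij.1 - 1).choose ij.1 : ℝ) * ((q + ij.2 - 1).choose ij.2 : ℝ) *
          multipleZeta ![m + ij.1, q + ij.2]
      = ∑ ij ∈ Finset.HasAntidiagonal.antidiagonal (q - 1),
        (-1 : ℝ) ^ ij.2 * ((m + ij.1 - 1).choose ij.1 : ℝ) * ((p + ij.2 - 1).choose ij.2 : ℝ) *
          (multipleZeta ![m + ij.1] * multipleZeta ![p + ij.2])) ∧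
    (∑ ij ∈ Finset.HasAntidiagonal.antidiagonal (m - 1),
        ((p + ij.1 - 1).choose ij.1 : ℝ) * ((q + ij.2 - 1).choose ij.2 : ℝ) *
          multipleT ![p + ij.1, q + ij.2]
      - (-1 : ℝ) ^ q * ∑ ij ∈ Finset.HasAntidiagonal.antidiagonal (p - 1),
        ((m + ij.1 - 1).choose ij.1 : ℝ) * ((q + ij.2 - 1).choose ij.2 : ℝ) *
          multipleT ![m + ij.1, q + ij.2]
      = ∑ ij ∈ Finset.HasAntidiagonal.antidiagonal (q - 1),
        (-1 : ℝ) ^ ij.2 * ((m + ij.1 - 1).choose ij.1 : ℝ) * ((p + ij.2 - 1).choose ij.2 : ℝ) *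
          (multipleT ![m + ij.1] * multipleT ![p + ij.2])) := by
  constructor
  · simp only [multipleZeta_one, multipleZeta_two]
    exact doubleSum_relation (fun _ h => h) hq hp hm
  · have h := doubleSum_relation (S := {x | x % 2 = 1})
      (fun x (hx : x % 2 = 1) => by omega) hq hp hm
    simp only [multipleT_one, multipleT_two]
    -- Every term carries the factor `2 ^ 2`, on the right as `2 * 2`.
    simp only [mul_mul_mul_comm (2 : ℝ) _ 2, mul_left_comm _ ((2 : ℝ) ^ 2), ← sq,
      ← Finset.mul_sum, ← mul_sub, h]
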